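/- Let $K$ be a field and let $(\mathcal F,\partial,\int)$ be an ordinary integro-differential algebra over $K$: $\mathcal F$ is a commutative $K$-algebra, $\partial:\mathcal F\to\mathcal F$ is a $K$-linear derivation with $\dim_K\ker\partial=1$, and $\int:\mathcal F\to\mathcal F$ is a $K$-linear map with $\partial\int f=f$ and $(\int f')(\int g')+\int (fg)'=(\int f')g+f(\int g')$ for all $f,g\in\mathcal F$, where $f'=\partial f$. Its evaluation $\mathbf e=1-\int\circ\partial$ takes values in $\ker\partial=K$ and is a character, i.e. a $K$-algebra homomorphism $\mathcal F\to K$. Let $\Phi$ be any set of characters of $\mathcal F$. Let $\mathcal F_\Phi[\partial,\int]$ be the free $K$-algebra generated by $\partial$, $\int$, all functions $f\in\mathcal F$ and all characters $\varphi\in\Phi\cup\{\mathbf e\}$ (with the unit function identified with the unit of the algebra), modulo the two-sided ideal generated by the relations $$fg=f\cdot g,\quad \varphi\psi=\psi,\quad \varphi f=\varphi(f)\,\varphi,\quad \partial f=f\partial+f',\quad \partial\varphi=0,\quad \partial{\textstyle\int}=1,$$ $${\textstyle\int} f{\textstyle\int}=({\textstyle\int}\cdot f)\,{\textstyle\int}-{\textstyle\int}\,({\textstyle\int}\cdot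 f),\quad {\textstyle\int} f\partial=f-{\textstyle\int} f'-\mathbf e(f)\,\mathbf e,\quad {\textstyle\int} f\varphi=({\textstyle\int}\cdot f)\,\varphi$$ for all $f,g\in\mathcal F$ and $\varphi,\psi\in\Phi\cup\{\mathbf e\}$, where $f\cdot g$, $f'$ and ${\textstyle\int}\cdot f$ denote the elements of $\mathcal F$ obtained by multiplying, differentiating and integrating in $\mathcal F$. In it, let $\mathcal F[\partial]$ be the subalgebra generated by $\partial$ and the functions, let $\mathcal F[\int]$ be the $K$-span of all $f\int g$ with $f,g\in\mathcal F$, and let $(\Phi)$ be the two-sided ideal generated by the characters in $\Phi\cup\{\mathbf e\}$ (if $\Phi\neq\emptyset$ this is the two-sided ideal generated by $\Phi$, since $\varphi\mathbf e=\mathbf e$). Then, as $K$-vector spaces, $$\mathcal F_\Phi[\partial,{\textstyle\int}]=\mathcal F[\partial]\oplus\mathcal F[{\textstyle\int}]\oplus(\Phi).$$ The same direct decomposition, with summands defined in the same way, holds for the expanded integro-differential operators $\mathcal F_\Phi^{\#}[\partial,\int]$, the quotient of $\mathcal F_\Phi[\partial,\int]$ by all $K$-linear relations that hold between functions in $\mathcal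 F$ (so that a sum or scalar multiple of functions is the same whether formed in $\mathcal F$ or in the operator algebra). -/

import Mathlib

/-- An integro-differential algebra structure on a commutative `K`-algebra `F`: a `K`-linear
derivation `der` and a `K`-linear section `int` of it that satisfies the differential
Baxter axiom. -/
structure IntDiffAlg (K F : Type*) [Field K] [CommRing F] [Algebra K F] where
  /-- the derivation `∂` -/
  der : Derivation K F F
  /-- the integral `∫` -/
  int : F →ₗ[K] F
  /-- section axiom -/
  der_int : ∀ f : F, der (int f) = f
  /-- differential Baxter axiom -/
  baxter : ∀ f g : F,
    int (der f) * int (der g) + int (der (f * g)) = int (der f) * g + f * int (der g)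

/-- An ordinary integro-differential algebra: the space of constants `ker ∂` is
one-dimensional over the ground field. -/
structure OrdIntDiffAlg (K F : Type*) [Field K] [CommRing F] [Algebra K F]
    extends IntDiffAlg K F where
  /-- the constants are one-dimensional -/
  ordinary : Module.finrank K (LinearMap.ker (der : F →ₗ[K] F)) = 1

namespace OrdIntDiffAlg

section

variable {K F : Type*} [Field K] [CommRing F] [Algebra K F]

theorem algebraMap_inj (D : OrdIntDiffAlg K F) : Function.Injective (algebraMap K F) := by
  have : Nontrivial F := by
    by_contra h
    rw [not_nontrivial_iff_subsingleton] at h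
    have h1 := D.ordinary
    rw [Module.finrank_zero_of_subsingleton] at h1
    exact zero_ne_one h1
  exact (algebraMap K F).injective

variable (D : OrdIntDiffAlg K F)

theorem exists_scalar (f : F) : ∃ c : K, algebraMap K F c = f - D.int (D.der f) := by
  have h1 : (1 : F) ≠ 0 := fun h => one_ne_zero
    (D.algebraMap_inj (by rw [map_one, map_zero, h]) : (1 : K) = 0)
  let v : LinearMap.ker (D.der : F →ₗ[K] F) := ⟨1, by simp⟩
  have hv : v ≠ 0 := fun h => h1 (congrArg Subtype.val h)
  obtain ⟨c, hc⟩ := (finrank_eq_one_iff_of_nonzero' v hv).1 D.ordinary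
    ⟨f - D.int (D.der f), by simp [D.der_int]⟩
  refine ⟨c, ?_⟩
  have := congrArg Subtype.val hc
  simpa [v, Algebra.algebraMap_eq_smul_one] using this

/-- The scalar `c` with `c • 1 = f - ∫ ∂ f`. -/
noncomputable def evFun (f : F) : K := (D.exists_scalar f).choose

theorem algebraMap_evFun (f : F) : algebraMap K F (D.evFun f) = f - D.int (D.der f) :=
  (D.exists_scalar f).choose_spec

/-- The evaluation `e = 1 - ∫ ∘ ∂`, viewed as a character: its values are constants, that is,
scalars (see `algebraMap_ev`). -/
noncomputable def ev : F →ₐ[K] K :=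
  AlgHom.ofLinearMap
    { toFun := D.evFun
      map_add' := fun f g => D.algebraMap_inj (by
        simp only [map_add, algebraMap_evFun]; ring)
      map_smul' := fun c f => D.algebraMap_inj (by
        simp only [RingHom.id_apply, smul_eq_mul, map_mul, algebraMap_evFun, ← Algebra.smul_def,
          smul_sub, map_smul, Derivation.map_smul]) }
    (D.algebraMap_inj (by
      change algebraMap K F (D.evFun 1) = _
      simp [algebraMap_evFun]))
    (fun f g => D.algebraMap_inj (by
      change algebraMap K F (D.evFun (f * g)) = algebraMap K F (D.evFun f * D.evFun g)
      rw [map_mul]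
      simp only [algebraMap_evFun]
      linear_combination -(D.baxter f g)))

theorem algebraMap_ev (f : F) : algebraMap K F (D.ev f) = f - D.int (D.der f) :=
  D.algebraMap_evFun f

/-- The characters `Φ ∪ {e}` used as generators. -/
abbrev Chars (Φ : Set (F →ₐ[K] K)) : Type _ :=
  {φ : F →ₐ[K] K // φ ∈ Φ ∪ {D.ev}}

/-- The generators of the integro-differential operators: `∂`, `∫`, every function `f ∈ F`, and
every character `φ ∈ Φ ∪ {e}`. -/
inductive Gen (Φ : Set (F →ₐ[K] K)) : Type _
  | der : Gen Φ
  | int : Gen Φ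
  | fn (f : F) : Gen Φ
  | chr (φ : D.Chars Φ) : Gen Φ

/-- The free `K`-algebra on the generators. -/
abbrev Free (Φ : Set (F →ₐ[K] K)) : Type _ := FreeAlgebra K (D.Gen Φ)

namespace Free

variable {D} {Φ : Set (F →ₐ[K] K)}

/-- The generator `∂`. -/
def der : D.Free Φ := FreeAlgebra.ι K Gen.der
/-- The generator `∫`. -/
def int : D.Free Φ := FreeAlgebra.ι K Gen.int
/-- The generator of the function `f`. -/
def fn (f : F) : D.Free Φ := FreeAlgebra.ι K (Gen.fn f)
/-- The generator of the character `φ`. -/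
def chr (φ : D.Chars Φ) : D.Free Φ := FreeAlgebra.ι K (Gen.chr φ)

end Free

open Free in
/-- The nine rewrite rules of the integro-differential operators (left-hand side, right-hand
side), for all functions `f`, `g` and characters `φ`, `ψ`. The unit function is the unit of the
operator algebra, so that the rules for `∫ f ∫`, `∫ f ∂`, `∫ f φ` include the instances
in which `f` is absent. The scalars `φ f` enter as coefficients. -/
inductive Rule (Φ : Set (F →ₐ[K] K)) : D.Free Φ → D.Free Φ → Prop
  | one : Rule Φ (fn 1) 1
  | fn_fn (f g : F) : Rule Φ (fn f * fn g) (fn (f * g))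
  | chr_chr (φ ψ : D.Chars Φ) : Rule Φ (chr φ * chr ψ) (chr ψ)
  | chr_fn (φ : D.Chars Φ) (f : F) : Rule Φ (chr φ * fn f) (φ.1 f • chr φ)
  | der_fn (f : F) : Rule Φ (der * fn f) (fn f * der + fn (D.der f))
  | der_chr (φ : D.Chars Φ) : Rule Φ (der * chr φ) 0
  | der_int : Rule Φ (der * int) 1
  | int_fn_int (f : F) :
      Rule Φ (int * fn f * int) (fn (D.int f) * int - int * fn (D.int f))
  | int_fn_der (f : F) :
      Rule Φ (int * fn f * der)
        (fn f - int * fn (D.der f) - D.ev f • chr ⟨D.ev, Or.inr rfl⟩)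
  | int_fn_chr (f : F) (φ : D.Chars Φ) :
      Rule Φ (int * fn f * chr φ) (fn (D.int f) * chr φ)

open Free in
/-- The rewrite rules together with the `K`-linear relations that hold between functions. -/
inductive LinRule (Φ : Set (F →ₐ[K] K)) : D.Free Φ → D.Free Φ → Prop
  | of_rule {x y : D.Free Φ} (h : D.Rule Φ x y) : LinRule Φ x y
  | fn_add (f g : F) : LinRule Φ (fn (f + g)) (fn f + fn g)
  | fn_smul (c : K) (f : F) : LinRule Φ (fn (c • f)) (c • fn f)

/-- The integro-differential operators `F_Φ[∂,∫]`: the free algebra modulo the two-sided ideal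
generated by the differences of the two sides of the rewrite rules. -/
abbrev Op (Φ : Set (F →ₐ[K] K)) : Type _ := RingQuot (D.Rule Φ)

/-- The expanded integro-differential operators `F_Φ^#[∂,∫]`, in which moreover all `K`-linear
relations between functions hold. -/
abbrev ExpOp (Φ : Set (F →ₐ[K] K)) : Type _ := RingQuot (D.LinRule Φ)

section Summands

variable (Φ : Set (F →ₐ[K] K)) (r : D.Free Φ → D.Free Φ → Prop)

/-- The differential operators `F[∂]`: the subalgebra generated by `∂` and the functions. -/
def diffOps : Submodule K (RingQuot r) :=
  Subalgebra.toSubmodule (Algebra.adjoin K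
    ({RingQuot.mkAlgHom K r Free.der} ∪ Set.range fun f => RingQuot.mkAlgHom K r (Free.fn f)))

/-- The integral operators `F[∫]`: the linear combinations of the monomials `f ∫ g`. -/
def intOps : Submodule K (RingQuot r) :=
  Submodule.span K (Set.range fun p : F × F =>
    RingQuot.mkAlgHom K r (Free.fn p.1 * Free.int * Free.fn p.2))

/-- The boundary operators `(Φ)`: the two-sided ideal generated by the characters. Here `e` is
counted among the characters; if `Φ` is nonempty this changes nothing, because `φ e = e`. -/
def bdryOps : Submodule K (RingQuot r) :=
  (TwoSidedIdeal.asIdeal (TwoSidedIdeal.span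
    (Set.range fun φ : D.Chars Φ => RingQuot.mkAlgHom K r (Free.chr φ)))).restrictScalars K

end Summands

end

end OrdIntDiffAlg

/-! Spanning: the sum of the three summands contains `1` and is stable under left multiplication by
every generator. The only rule with some content is `∫ a ∂ = a - ∫ a' - c e`, which pushes `∫`
through a differential operator one power of `∂` at a time (`int_mul_ofCoeffs`).

Independence: modulo characters `∫` becomes a two-sided inverse of `∂`, so a module is built on
which `∂` is bijective, `∫` acts as its inverse and characters act as zero. Let `A` be the
commutative algebra generated by the functions inside the operator algebra, with derivation `[∂, ·]`
and constants `C`. Without the linear relations `A` need not be `F`, and `C` need not be `K`. The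
module is `A[∂] ⊕ A ∂⁻¹ A`, the second summand being `A ⊗ A` over `C`; the tensor product is over
`C` because constants commute with `∫` (`constants_comm_int`). Bijectivity of `∂`
(`mulDer_injective`, `mulDer_surjective`) needs only that the derivation of `A` is surjective. On
the vector `1`, a differential operator plus an integral operator returns exactly its coefficients,
while `(Φ)` acts as zero (`eq_zero_of_add_eq_zero`). -/

open scoped TensorProduct

/-! ### The module `A[∂] ⊕ A ∂⁻¹ A` of a surjective derivation -/

namespace Derivation

section

variable {K A : Type*} [CommRing K] [CommRing A] [Algebra K A] (δ : Derivation K A A)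

/-- The constants of a derivation. -/
def constants : Subalgebra K A where
  carrier := {a | δ a = 0}
  mul_mem' := fun {a b} (ha : δ a = 0) (hb : δ b = 0) => by simp [ha, hb]
  add_mem' := fun {a b} (ha : δ a = 0) (hb : δ b = 0) => by simp [ha, hb]
  algebraMap_mem' := fun c => δ.map_algebraMap c

/-- A derivation is linear over its constants. -/
def constLinear : A →ₗ[δ.constants] A where
  toFun := δ
  map_add' := map_add δ
  map_smul' := fun c a => by
    have hc : δ c = 0 := c.2
    simp [Subalgebra.smul_def, hc]

/-- The module `A[∂] ⊕ A ∂⁻¹ A` on which a derivation acts invertibly; the second summand is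
`A ⊗ A` over the constants, with `a ⊗ b` standing for `a ∂⁻¹ b`. -/
abbrev PseudoOp : Type _ := (ℕ →₀ A) × (A ⊗[δ.constants] A)

/-- The derivation on the left factor of `A ⊗ A`. -/
def tensorLeft : A ⊗[δ.constants] A →ₗ[δ.constants] A ⊗[δ.constants] A :=
  δ.constLinear.rTensor A

@[simp] theorem tensorLeft_tmul (a b : A) : δ.tensorLeft (a ⊗ₜ b) = δ a ⊗ₜ[δ.constants] b := rfl

theorem tensorLeft_smul (a : A) (t : A ⊗[δ.constants] A) :
    δ.tensorLeft (a • t) = a • δ.tensorLeft t + δ a • t := by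
  induction t with
  | zero => simp
  | add x y hx hy => simp only [smul_add, map_add, hx, hy]; abel
  | tmul x y =>
    simp only [TensorProduct.smul_tmul', tensorLeft_tmul, ← TensorProduct.add_tmul, smul_eq_mul,
      Derivation.leibniz]
    rw [mul_comm x]

/-- Left multiplication by `∂` on `A[∂] ⊕ A ∂⁻¹ A`. -/
noncomputable def mulDer : Module.End K δ.PseudoOp :=
  ((Finsupp.lmapDomain A K Nat.succ + Finsupp.mapRange.linearMap (δ : A →ₗ[K] A)) ∘ₗ
      LinearMap.fst K _ _ +
    Finsupp.lsingle 0 ∘ₗ (LinearMap.mul' δ.constants A).restrictScalars K ∘ₗ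
      LinearMap.snd K _ _).prod
  (δ.tensorLeft.restrictScalars K ∘ₗ LinearMap.snd K _ _)

theorem mulDer_apply (v : δ.PseudoOp) : δ.mulDer v =
    (v.1.mapDomain Nat.succ + v.1.mapRange δ (map_zero δ) +
      Finsupp.single 0 (LinearMap.mul' δ.constants A v.2), δ.tensorLeft v.2) := rfl

/-- This is `∂ a = a ∂ + δ a` as operators; all rules for the module that mix functions with `∂` or
`∂⁻¹` come from it. -/
theorem mulDer_smul (a : A) (v : δ.PseudoOp) :
    δ.mulDer (a • v) = a • δ.mulDer v + δ a • v := by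
  have h : LinearMap.mul' δ.constants A (a • v.2) = a • LinearMap.mul' δ.constants A v.2 := by
    induction v.2 with
    | zero => simp
    | add x y hx hy => simp only [smul_add, map_add, hx, hy]
    | tmul x y => simp [TensorProduct.smul_tmul', mul_assoc]
  refine Prod.ext ?_ ?_
  · simp only [mulDer_apply, Prod.smul_fst, Prod.smul_snd, Prod.fst_add, h, Finsupp.mapDomain_smul]
    ext n
    simp [mul_comm (v.1 n), Finsupp.single_apply]
    split_ifs <;> ring
  · simp [mulDer_apply, tensorLeft_smul]

theorem mulDer_injective (hδ : Function.Surjective δ) : Function.Injective δ.mulDer := by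
  rw [← LinearMap.ker_eq_bot, LinearMap.ker_eq_bot']
  rintro ⟨p, t⟩ h
  rw [mulDer_apply, Prod.mk_eq_zero] at h
  obtain ⟨h1, h2⟩ := h
  have hp : ∀ n, p n = 0 := by
    by_contra! hne
    have hs : p.support.Nonempty := by
      obtain ⟨n, hn⟩ := hne
      exact ⟨n, Finsupp.mem_support_iff.2 hn⟩
    have hmax := Finset.max'_mem _ hs
    set m := p.support.max' hs
    -- The coefficient of `∂ p` at `m + 1` is `p m + δ (p (m + 1))`, and the tensor part only
    -- contributes in degree `0`; so the leading coefficient `p m` would vanish.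
    have hm : p (m + 1) = 0 := by
      by_contra hm
      have := Finset.le_max' _ _ (Finsupp.mem_support_iff.2 hm)
      omega
    have := DFunLike.congr_fun h1 (m + 1)
    simp only [Finsupp.coe_add, Pi.add_apply, Finsupp.mapRange_apply, hm, map_zero, add_zero,
      Finsupp.mapDomain_apply Nat.succ_injective p m, Finsupp.coe_zero, Pi.zero_apply,
      Finsupp.single_apply, if_false, (Nat.succ_ne_zero m).symm] at this
    exact Finsupp.mem_support_iff.1 hmax this
  obtain rfl : p = 0 := Finsupp.ext hp
  have hex : Function.Exact (Submodule.subtype (LinearMap.ker δ.constLinear)) δ.constLinear :=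
    LinearMap.exact_subtype_ker_map _
  obtain ⟨s, rfl⟩ := ((rTensor_exact A hex hδ) t).1 h2
  -- By right exactness the kernel of `δ ⊗ id` comes from constants on the left factor, and these
  -- move across the tensor sign.
  have hs : ∀ s, ∃ b : A, LinearMap.rTensor A (Submodule.subtype (LinearMap.ker δ.constLinear)) s
      = 1 ⊗ₜ[δ.constants] b := by
    intro s
    induction s with
    | zero => exact ⟨0, by simp⟩
    | add x y hx hy =>
      obtain ⟨b, hb⟩ := hx
      obtain ⟨c, hc⟩ := hy
      exact ⟨b + c, by rw [map_add, hb, hc, TensorProduct.tmul_add]⟩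
    | tmul x y =>
      let c : δ.constants := ⟨x.1, x.2⟩
      refine ⟨c • y, ?_⟩
      rw [← TensorProduct.smul_tmul]
      simp [c, Subalgebra.smul_def]
  obtain ⟨b, hb⟩ := hs s
  rw [hb] at h1 ⊢
  -- The degree `0` coefficient of `∂ (1 ⊗ b)` is `b` itself.
  have hb0 : b = 0 := by simpa using h1
  simp [hb0]

theorem mulDer_surjective (hδ : Function.Surjective δ) : Function.Surjective δ.mulDer := by
  have h1 : ∀ (n : ℕ) (a : A),
      ((Finsupp.single n a, 0) : δ.PseudoOp) ∈ LinearMap.range δ.mulDer := by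
    intro n
    induction n with
    | zero =>
      intro a
      exact ⟨(0, 1 ⊗ₜ a), by simp [mulDer_apply]⟩
    | succ n ih =>
      intro a
      -- `a ∂ⁿ⁺¹ = ∂ (a ∂ⁿ) - δ(a) ∂ⁿ`.
      have h : ((Finsupp.single (n + 1) a, 0) : δ.PseudoOp) =
          δ.mulDer (Finsupp.single n a, 0) - (Finsupp.single n (δ a), 0) := by
        simp [mulDer_apply]
      rw [h]
      exact sub_mem ⟨_, rfl⟩ (ih _)
  have h2 : ∀ p : ℕ →₀ A, ((p, 0) : δ.PseudoOp) ∈ LinearMap.range δ.mulDer := by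
    intro p
    induction p using Finsupp.induction_linear with
    | zero => exact zero_mem _
    | add f g hf hg =>
      have : ((f + g, 0) : δ.PseudoOp) = (f, 0) + (g, 0) := by simp
      rw [this]
      exact add_mem hf hg
    | single n a => exact h1 n a
  rintro ⟨p, t⟩
  obtain ⟨s, hs⟩ := LinearMap.rTensor_surjective A (g := δ.constLinear) hδ t
  have h : ((p, t) : δ.PseudoOp) =
      δ.mulDer (0, s) + (p - Finsupp.single 0 (LinearMap.mul' δ.constants A s), 0) := by
    refine Prod.ext ?_ ?_
    · simp [mulDer_apply]
    · simp only [mulDer_apply, Prod.snd_add, add_zero]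
      exact hs.symm
  exact h ▸ add_mem (LinearMap.mem_range_self _ _) (h2 _)

/-- Left multiplication by `∂` on `A[∂] ⊕ A ∂⁻¹ A` as an automorphism. -/
noncomputable def mulDerEquiv (hδ : Function.Surjective δ) : δ.PseudoOp ≃ₗ[K] δ.PseudoOp :=
  LinearEquiv.ofBijective δ.mulDer ⟨δ.mulDer_injective hδ, δ.mulDer_surjective hδ⟩

@[simp] theorem mulDerEquiv_apply (hδ : Function.Surjective δ) (v : δ.PseudoOp) :
    δ.mulDerEquiv hδ v = δ.mulDer v := rfl

theorem mulDer_symm_apply (hδ : Function.Surjective δ) (v : δ.PseudoOp) :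
    δ.mulDer ((δ.mulDerEquiv hδ).symm v) = v := (δ.mulDerEquiv hδ).apply_symm_apply v

theorem mulDerEquiv_symm_single (hδ : Function.Surjective δ) (a : A) :
    (δ.mulDerEquiv hδ).symm (Finsupp.single 0 a, 0) = (0, 1 ⊗ₜ a) := by
  rw [LinearEquiv.symm_apply_eq]
  simp [mulDer_apply]

theorem smul_mulDerEquiv_symm_smul_one (hδ : Function.Surjective δ) (a b : A) :
    a • (δ.mulDerEquiv hδ).symm (b • (Finsupp.single 0 1, 0)) = (0, a ⊗ₜ b) := by
  have h : (b • (Finsupp.single 0 1, 0) : δ.PseudoOp) = (Finsupp.single 0 b, 0) := by simp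
  rw [h, mulDerEquiv_symm_single]
  simp [TensorProduct.smul_tmul']

theorem mulDer_pow_one (n : ℕ) :
    (δ.mulDer ^ n) (Finsupp.single 0 1, 0) = (Finsupp.single n 1, 0) := by
  induction n with
  | zero => simp
  | succ n ih =>
    rw [pow_succ', Module.End.mul_apply, ih]
    simp [mulDer_apply]

theorem smul_mulDer_pow_one (a : A) (n : ℕ) :
    a • (δ.mulDer ^ n) (Finsupp.single 0 1, 0) = (Finsupp.single n a, 0) := by
  rw [mulDer_pow_one]
  simp

end

end Derivation

/-! ### Realizations of the rules -/

namespace OrdIntDiffAlg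

section

variable {K F : Type*} [Field K] [CommRing F] [Algebra K F]

/-- Elements of a `K`-algebra that satisfy the rules of the integro-differential operators. -/
structure Realization (D : OrdIntDiffAlg K F) (Φ : Set (F →ₐ[K] K)) (O : Type*)
    [Ring O] [Algebra K O] where
  /-- the derivation -/
  der : O
  /-- the integral -/
  int : O
  /-- the functions -/
  fn : F →* O
  /-- the characters -/
  chr : D.Chars Φ → O
  chr_chr (φ ψ : D.Chars Φ) : chr φ * chr ψ = chr ψ
  chr_fn (φ : D.Chars Φ) (f : F) : chr φ * fn f = φ.1 f • chr φ
  der_fn (f : F) : der * fn f = fn f * der + fn (D.der f)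
  der_chr (φ : D.Chars Φ) : der * chr φ = 0
  der_int : der * int = 1
  int_fn_int (f : F) : int * fn f * int = fn (D.int f) * int - int * fn (D.int f)
  int_fn_der (f : F) : int * fn f * der =
    fn f - int * fn (D.der f) - D.ev f • chr ⟨D.ev, Or.inr rfl⟩
  int_fn_chr (f : F) (φ : D.Chars Φ) : int * fn f * chr φ = fn (D.int f) * chr φ

namespace Realization

variable {D : OrdIntDiffAlg K F} {Φ : Set (F →ₐ[K] K)} {O : Type*} [Ring O] [Algebra K O]

/-- The value of a realization on a generator. -/
def onGen (R : D.Realization Φ O) : D.Gen Φ → O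
  | .der => R.der
  | .int => R.int
  | .fn f => R.fn f
  | .chr φ => R.chr φ

/-- The extension of a realization to the free algebra. -/
def onFree (R : D.Realization Φ O) : D.Free Φ →ₐ[K] O := FreeAlgebra.lift K R.onGen

section onFree

variable (R : D.Realization Φ O)

@[simp] theorem onFree_der : R.onFree Free.der = R.der := FreeAlgebra.lift_ι_apply ..
@[simp] theorem onFree_int : R.onFree Free.int = R.int := FreeAlgebra.lift_ι_apply ..
@[simp] theorem onFree_fn (f : F) : R.onFree (Free.fn f) = R.fn f := FreeAlgebra.lift_ι_apply ..
@[simp] theorem onFree_chr (φ : D.Chars Φ) : R.onFree (Free.chr φ) = R.chr φ :=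
  FreeAlgebra.lift_ι_apply ..

theorem onFree_eq_of_rule {x y : D.Free Φ} (h : D.Rule Φ x y) : R.onFree x = R.onFree y := by
  cases h with
  | one => simp
  | fn_fn f g => simp
  | chr_chr φ ψ => simp [R.chr_chr]
  | chr_fn φ f => simp [R.chr_fn]
  | der_fn f => simp [R.der_fn]
  | der_chr φ => simp [R.der_chr]
  | der_int => simp [R.der_int]
  | int_fn_int f => simp [R.int_fn_int]
  | int_fn_der f => simp [R.int_fn_der]
  | int_fn_chr f φ => simp [R.int_fn_chr]

end onFree

/-- The realization in a quotient of the free algebra by relations that include the rules. -/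
def ofRel {r : D.Free Φ → D.Free Φ → Prop} (hr : ∀ x y, D.Rule Φ x y → r x y) :
    D.Realization Φ (RingQuot r) :=
  have h : ∀ {x y}, D.Rule Φ x y → RingQuot.mkAlgHom K r x = RingQuot.mkAlgHom K r y :=
    fun hxy => RingQuot.mkAlgHom_rel K (hr _ _ hxy)
  { der := RingQuot.mkAlgHom K r Free.der
    int := RingQuot.mkAlgHom K r Free.int
    fn :=
      { toFun := fun f => RingQuot.mkAlgHom K r (Free.fn f)
        map_one' := by rw [h .one, map_one]
        map_mul' := fun f g => by rw [← h (.fn_fn f g), map_mul] }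
    chr := fun φ => RingQuot.mkAlgHom K r (Free.chr φ)
    chr_chr := fun φ ψ => by simpa using h (.chr_chr φ ψ)
    chr_fn := fun φ f => by simpa using h (.chr_fn φ f)
    der_fn := fun f => by simpa using h (.der_fn f)
    der_chr := fun φ => by simpa using h (.der_chr φ)
    der_int := by simpa using h .der_int
    int_fn_int := fun f => by simpa using h (.int_fn_int f)
    int_fn_der := fun f => by simpa using h (.int_fn_der f)
    int_fn_chr := fun f φ => by simpa using h (.int_fn_chr f φ) }

/-! ### The algebra generated by the functions and its derivation -/

variable (R : D.Realization Φ O)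

/-- The algebra generated by the functions. -/
abbrev fnAlg : Subalgebra K O := Algebra.adjoin K (Set.range R.fn)

instance : CommRing R.fnAlg :=
  { R.fnAlg.toRing with
    mul_comm := (Algebra.isMulCommutative_adjoin K (s := Set.range R.fn) (by
      rintro _ ⟨f, rfl⟩ _ ⟨g, rfl⟩
      rw [← map_mul, mul_comm, map_mul])).is_comm.comm }

/-- Products of functions are functions. Sums need not be, since `R.fn` is only multiplicative. -/
theorem fnAlg_eq_span : Subalgebra.toSubmodule R.fnAlg = Submodule.span K (Set.range R.fn) := by
  refine Algebra.adjoin_eq_span_of_subset K ?_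
  have : Submonoid.closure (Set.range R.fn) = MonoidHom.mrange R.fn := by
    rw [← MonoidHom.coe_mrange, Submonoid.closure_eq]
  rw [this]
  exact Submodule.subset_span

/-- A function as an element of the algebra generated by the functions. -/
def toFnAlg (f : F) : R.fnAlg := ⟨R.fn f, Algebra.subset_adjoin ⟨f, rfl⟩⟩

theorem fnAlg_induction {p : R.fnAlg → Prop} (fn : ∀ f, p (R.toFnAlg f)) (zero : p 0)
    (add : ∀ a b, p a → p b → p (a + b)) (smul : ∀ (c : K) a, p a → p (c • a)) (a : R.fnAlg) :
    p a := by
  obtain ⟨a, ha⟩ := a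
  have ha' : a ∈ Submodule.span K (Set.range R.fn) := R.fnAlg_eq_span ▸ ha
  induction ha' using Submodule.span_induction with
  | mem x hx => obtain ⟨f, rfl⟩ := hx; exact fn f
  | zero => exact zero
  | add x y hx hy ihx ihy =>
    rw [← fnAlg_eq_span] at hx hy
    exact add _ _ (ihx hx) (ihy hy)
  | smul c x hx ih =>
    rw [← fnAlg_eq_span] at hx
    exact smul _ _ (ih hx)

theorem commutator_mem (a : R.fnAlg) : R.der * a - a * R.der ∈ R.fnAlg := by
  induction a using R.fnAlg_induction with
  | fn f => simpa [toFnAlg, R.der_fn] using (R.toFnAlg (D.der f)).2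
  | zero => simp
  | add a b ha hb =>
    convert add_mem ha hb using 1
    push_cast
    noncomm_ring
  | smul c a ha =>
    convert R.fnAlg.smul_mem ha c using 1
    simp [smul_sub]

/-- The commutator with `∂` as a derivation of the algebra generated by the functions. -/
def fnDer : Derivation K R.fnAlg R.fnAlg :=
  Derivation.mk'
    { toFun := fun a => ⟨R.der * a - a * R.der, R.commutator_mem a⟩
      map_add' := fun a b => Subtype.ext (by push_cast; noncomm_ring)
      map_smul' := fun c a => Subtype.ext (by simp [smul_sub]) }
    (fun a b => Subtype.ext (by
      change R.der * (a * b : O) - (a * b : O) * R.der =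
        a * (R.der * b - b * R.der : O) +
          ((b * ⟨R.der * a - a * R.der, R.commutator_mem a⟩ : R.fnAlg) : O)
      rw [mul_comm b]
      push_cast
      noncomm_ring))

theorem coe_fnDer (a : R.fnAlg) : (R.fnDer a : O) = R.der * a - a * R.der := rfl

theorem der_mul_coe (a : R.fnAlg) : R.der * a = a * R.der + R.fnDer a := by
  rw [coe_fnDer]; abel

theorem fnDer_toFnAlg (f : F) : R.fnDer (R.toFnAlg f) = R.toFnAlg (D.der f) :=
  Subtype.ext (by simp [coe_fnDer, toFnAlg, R.der_fn])

theorem fnDer_surjective : Function.Surjective R.fnDer := by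
  intro a
  change a ∈ Set.range R.fnDer
  induction a using R.fnAlg_induction with
  | fn f => exact ⟨R.toFnAlg (D.int f), by rw [fnDer_toFnAlg, D.der_int]⟩
  | zero => exact ⟨0, map_zero _⟩
  | add a b ha hb =>
    obtain ⟨a, rfl⟩ := ha
    obtain ⟨b, rfl⟩ := hb
    exact ⟨a + b, map_add _ _ _⟩
  | smul c a ha =>
    obtain ⟨a, rfl⟩ := ha
    exact ⟨c • a, Derivation.map_smul _ _ _⟩

/-- Forced without any linear relation: commuting `∂` with the unit function leaves the term `1' =
0`. -/
theorem fn_zero : R.fn 0 = 0 := by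
  have := R.der_fn 1
  simpa using this

/-- The evaluation. -/
noncomputable def ev : O := R.chr ⟨D.ev, Or.inr rfl⟩

theorem int_mul_der : R.int * R.der = 1 - R.ev := by
  have := R.int_fn_der 1
  simpa [fn_zero, ev] using this

theorem ev_mul_int : R.ev * R.int = 0 := by
  have h : R.int * R.der * R.int = R.int := by rw [mul_assoc, R.der_int, mul_one]
  rw [int_mul_der, sub_mul, one_mul] at h
  simpa using h

/-- Only the existence of `c` is claimed: no evaluation on all of `R.fnAlg` has to be defined. -/
theorem int_mul_coe_mul_der (a : R.fnAlg) :
    ∃ c : K, R.int * a * R.der = a - R.int * R.fnDer a - c • R.ev := by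
  induction a using R.fnAlg_induction with
  | fn f => exact ⟨D.ev f, by rw [fnDer_toFnAlg]; exact R.int_fn_der f⟩
  | zero => exact ⟨0, by simp⟩
  | add a b ha hb =>
    obtain ⟨c, hc⟩ := ha
    obtain ⟨d, hd⟩ := hb
    refine ⟨c + d, ?_⟩
    rw [map_add]
    push_cast
    rw [mul_add, add_mul, hc, hd, mul_add, add_smul]
    abel
  | smul k a ha =>
    obtain ⟨c, hc⟩ := ha
    refine ⟨k * c, ?_⟩
    rw [Derivation.map_smul]
    simp [hc, smul_sub, mul_smul]

/-- The constants commute with the integral. -/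
theorem constants_comm_int {a : R.fnAlg} (ha : R.fnDer a = 0) : a * R.int = R.int * a := by
  obtain ⟨c, hc⟩ := R.int_mul_coe_mul_der a
  -- Right multiplication by `∫` removes the unknown scalar, since `e ∫ = 0`.
  have h := congrArg (· * R.int) hc
  simpa [sub_mul, mul_assoc, R.der_int, R.ev_mul_int, ha] using h.symm

theorem toFnAlg_one : R.toFnAlg 1 = 1 := Subtype.ext (map_one R.fn)

theorem toFnAlg_mul (f g : F) : R.toFnAlg (f * g) = R.toFnAlg f * R.toFnAlg g :=
  Subtype.ext (map_mul R.fn f g)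

/-- The realization on `A[∂] ⊕ A ∂⁻¹ A`, for `A` the algebra generated by the functions of a given
realization. The integral acts as the inverse of the derivation and the characters act as zero. -/
noncomputable def pseudo : D.Realization Φ (Module.End K R.fnDer.PseudoOp) where
  der := R.fnDer.mulDer
  int := (R.fnDer.mulDerEquiv R.fnDer_surjective).symm
  fn :=
    { toFun := fun f => Algebra.lsmul K K R.fnDer.PseudoOp (R.toFnAlg f)
      map_one' := by rw [toFnAlg_one, map_one]
      map_mul' := fun f g => by rw [toFnAlg_mul, map_mul] }
  chr := 0
  chr_chr := by simp
  chr_fn := by simp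
  der_fn := fun f => LinearMap.ext fun v => by
    simp [Derivation.mulDer_smul, fnDer_toFnAlg]
  der_chr := by simp
  der_int := LinearMap.ext fun v => by simp [Derivation.mulDer_symm_apply]
  int_fn_int := fun f => LinearMap.ext fun v => by
    -- After cancelling `∂` on the left, this rule and the next reduce to `∂ a = a ∂ + δ a`.
    apply R.fnDer.mulDer_injective R.fnDer_surjective
    simp [Derivation.mulDer_symm_apply, Derivation.mulDer_smul, fnDer_toFnAlg, D.der_int]
  int_fn_der := fun f => LinearMap.ext fun v => by
    apply R.fnDer.mulDer_injective R.fnDer_surjective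
    simp [Derivation.mulDer_symm_apply, Derivation.mulDer_smul, fnDer_toFnAlg]
  int_fn_chr := by simp

/-! ### Operators from coefficients, and recovery of the coefficients -/

/-- The differential operator with given coefficients. -/
noncomputable def ofCoeffs : (ℕ →₀ R.fnAlg) →ₗ[K] O :=
  Finsupp.lsum K fun n => LinearMap.mulRight K (R.der ^ n) ∘ₗ R.fnAlg.val.toLinearMap

@[simp] theorem ofCoeffs_single (n : ℕ) (a : R.fnAlg) :
    R.ofCoeffs (Finsupp.single n a) = a * R.der ^ n := by
  simp [ofCoeffs]

theorem der_mul_ofCoeffs (p : ℕ →₀ R.fnAlg) :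
    R.der * R.ofCoeffs p ∈ LinearMap.range R.ofCoeffs := by
  induction p using Finsupp.induction_linear with
  | zero => simp
  | add f g hf hg => rw [map_add, mul_add]; exact add_mem hf hg
  | single n a =>
    refine ⟨Finsupp.single (n + 1) a + Finsupp.single n (R.fnDer a), ?_⟩
    rw [map_add, ofCoeffs_single, ofCoeffs_single, ofCoeffs_single, ← mul_assoc, der_mul_coe,
      add_mul, pow_succ', mul_assoc]

theorem coe_mul_ofCoeffs (a : R.fnAlg) (p : ℕ →₀ R.fnAlg) :
    a * R.ofCoeffs p = R.ofCoeffs (a • p) := by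
  induction p using Finsupp.induction_linear with
  | zero => simp
  | add f g hf hg => rw [map_add, mul_add, hf, hg, smul_add, map_add]
  | single n b =>
    rw [Finsupp.smul_single, ofCoeffs_single, ofCoeffs_single, smul_eq_mul, Subalgebra.coe_mul,
      mul_assoc]

/-- The integral operator with given coefficients. -/
noncomputable def ofTensor : R.fnAlg ⊗[R.fnDer.constants] R.fnAlg →+ O :=
  TensorProduct.liftAddHom
    (AddMonoidHom.mk' (fun a => AddMonoidHom.mk' (fun b => (a : O) * R.int * b)
      fun b c => by push_cast; rw [mul_add])
      fun a b => by ext c; simp [add_mul])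
    (fun c a b => by
      -- Balancedness over the constants: `c` passes from the left of `∫` to its right.
      have h := R.constants_comm_int c.2
      simp only [AddMonoidHom.mk'_apply, Subalgebra.smul_def, smul_eq_mul]
      rw [mul_comm (c : R.fnAlg)]
      push_cast
      rw [mul_assoc (a : O), h]
      simp only [mul_assoc])

@[simp] theorem ofTensor_tmul (a b : R.fnAlg) :
    R.ofTensor (a ⊗ₜ b) = a * R.int * b := rfl

theorem ofTensor_smul (c : K) (t : R.fnAlg ⊗[R.fnDer.constants] R.fnAlg) :
    R.ofTensor (c • t) = c • R.ofTensor t := by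
  induction t with
  | zero => simp
  | add x y hx hy => simp only [smul_add, map_add, hx, hy]
  | tmul a b => simp [TensorProduct.smul_tmul']

theorem ofTensor_mem_span (t : R.fnAlg ⊗[R.fnDer.constants] R.fnAlg) :
    R.ofTensor t ∈ Submodule.span K (Set.range fun p : F × F => R.fn p.1 * R.int * R.fn p.2) := by
  induction t with
  | zero => simp
  | add x y hx hy => rw [map_add]; exact add_mem hx hy
  | tmul a b =>
    rw [ofTensor_tmul]
    induction a using R.fnAlg_induction with
    | zero => simp
    | add a a' h h' => push_cast; rw [add_mul, add_mul]; exact add_mem h h'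
    | smul c a h =>
      rw [Subalgebra.coe_smul, smul_mul_assoc, smul_mul_assoc]
      exact Submodule.smul_mem _ c h
    | fn f =>
      induction b using R.fnAlg_induction with
      | zero => simp
      | add a a' h h' => push_cast; rw [mul_add]; exact add_mem h h'
      | smul c a h =>
        rw [Subalgebra.coe_smul, mul_smul_comm]
        exact Submodule.smul_mem _ c h
      | fn g => exact Submodule.subset_span ⟨(f, g), rfl⟩

theorem int_mul_coe_mul_int (a : R.fnAlg) :
    ∃ b : R.fnAlg, R.int * a * R.int = b * R.int - R.int * b := by
  induction a using R.fnAlg_induction with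
  | fn f => exact ⟨R.toFnAlg (D.int f), R.int_fn_int f⟩
  | zero => exact ⟨0, by simp⟩
  | add a a' h h' =>
    obtain ⟨b, hb⟩ := h
    obtain ⟨b', hb'⟩ := h'
    refine ⟨b + b', ?_⟩
    push_cast
    rw [mul_add, add_mul, hb, hb']
    noncomm_ring
  | smul c a h =>
    obtain ⟨b, hb⟩ := h
    exact ⟨c • b, by simp [hb, smul_sub]⟩

section Action

variable {π : O →ₐ[K] Module.End K R.fnDer.PseudoOp} (hfn : ∀ f, π (R.fn f) = R.pseudo.fn f)

include hfn

theorem apply_coe (a : R.fnAlg) : π a = Algebra.lsmul K K R.fnDer.PseudoOp a := by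
  induction a using R.fnAlg_induction with
  | fn f => exact hfn f
  | zero => rw [map_zero, ZeroMemClass.coe_zero, map_zero]
  | add a b ha hb => rw [map_add, Subalgebra.coe_add, map_add, ha, hb]
  | smul c a ha => rw [map_smul, Subalgebra.coe_smul, map_smul, ha]

/-- The vector `1` is cyclic for the differential operators: `a ∂ⁿ` sends it to the basis element `a
∂ⁿ`. -/
theorem apply_ofCoeffs (hder : π R.der = R.pseudo.der) (p : ℕ →₀ R.fnAlg) :
    π (R.ofCoeffs p) (Finsupp.single 0 1, 0) = (p, 0) := by
  induction p using Finsupp.induction_linear with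
  | zero => rw [map_zero, map_zero]; rfl
  | add f g hf hg =>
    rw [map_add, map_add, LinearMap.add_apply, hf, hg, Prod.mk_add_mk, add_zero]
  | single n a =>
    rw [ofCoeffs_single, map_mul, Module.End.mul_apply, map_pow, hder, R.apply_coe hfn]
    exact R.fnDer.smul_mulDer_pow_one a n

theorem apply_ofTensor (hint : π R.int = R.pseudo.int)
    (t : R.fnAlg ⊗[R.fnDer.constants] R.fnAlg) :
    π (R.ofTensor t) (Finsupp.single 0 1, 0) = (0, t) := by
  induction t with
  | zero => rw [map_zero, map_zero]; rfl
  | add f g hf hg =>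
    rw [map_add, map_add, LinearMap.add_apply, hf, hg, Prod.mk_add_mk, add_zero]
  | tmul a b =>
    rw [ofTensor_tmul, map_mul, map_mul, Module.End.mul_apply, Module.End.mul_apply,
      R.apply_coe hfn, R.apply_coe hfn, hint]
    exact R.fnDer.smul_mulDerEquiv_symm_smul_one R.fnDer_surjective a b

theorem eq_zero_of_add_eq_zero (hder : π R.der = R.pseudo.der) (hint : π R.int = R.pseudo.int)
    {p : ℕ →₀ R.fnAlg} {t : R.fnAlg ⊗[R.fnDer.constants] R.fnAlg} {z : O} (hz : π z = 0)
    (h : R.ofCoeffs p + R.ofTensor t + z = 0) : p = 0 ∧ t = 0 := by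
  have h' := LinearMap.congr_fun (congrArg π h) (Finsupp.single 0 1, 0)
  rw [map_add, map_add, hz, add_zero, LinearMap.add_apply, R.apply_ofCoeffs hfn hder,
    R.apply_ofTensor hfn hint, map_zero, LinearMap.zero_apply, Prod.mk_add_mk,
    add_zero, zero_add] at h'
  exact Prod.mk_eq_zero.1 h'

end Action

end Realization

/-! ### Two general criteria from linear algebra -/

theorem adjoin_le_of_mul_mem {R' A : Type*} [CommSemiring R'] [Semiring A] [Algebra R' A]
    {s : Set A} {T : Submodule R' A} (h1 : 1 ∈ T) (h : ∀ x ∈ s, ∀ t ∈ T, x * t ∈ T) :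
    Subalgebra.toSubmodule (Algebra.adjoin R' s) ≤ T := by
  intro x hx
  suffices ∀ t ∈ T, x * t ∈ T by simpa using this 1 h1
  rw [Subalgebra.mem_toSubmodule] at hx
  induction hx using Algebra.adjoin_induction with
  | mem x hx => exact h x hx
  | algebraMap c =>
    intro t ht
    rw [← Algebra.smul_def]
    exact T.smul_mem c ht
  | add x y _ _ hx hy => intro t ht; rw [add_mul]; exact add_mem (hx t ht) (hy t ht)
  | mul x y _ _ hx hy => intro t ht; rw [mul_assoc]; exact hx _ (hy _ ht)

theorem isInternal_fin_three {R' M : Type*} [Ring R'] [AddCommGroup M] [Module R' M]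
    {p q s : Submodule R' M} (hsup : p ⊔ q ⊔ s = ⊤)
    (hind : ∀ x ∈ p, ∀ y ∈ q, ∀ z ∈ s, x + y + z = 0 → x = 0 ∧ y = 0 ∧ z = 0) :
    DirectSum.IsInternal (![p, q, s] : Fin 3 → Submodule R' M) := by
  rw [DirectSum.isInternal_submodule_iff_iSupIndep_and_iSup_eq_top]
  constructor
  · rw [iSupIndep_iff_finsetSum_eq_zero_imp_eq_zero]
    intro t v hv h0
    -- Extension of `v` by zero outside `t`, so that the sum runs over all three indices.
    let w : Fin 3 → M := fun i => if i ∈ t then v i else 0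
    have hw : ∀ i, w i ∈ (![p, q, s] : Fin 3 → Submodule R' M) i := fun i => by
      by_cases hi : i ∈ t
      · simpa only [w, if_pos hi] using hv i hi
      · simp only [w, if_neg hi, zero_mem]
    have hw0 : w 0 + w 1 + w 2 = 0 := by
      rw [← Fin.sum_univ_three]
      simpa [w] using h0
    obtain ⟨h1, h2, h3⟩ := hind _ (hw 0) _ (hw 1) _ (hw 2) hw0
    have hall : ∀ i, w i = 0 := by
      intro i
      fin_cases i <;> assumption
    intro i hi
    simpa [w, hi] using hall i
  · rw [eq_top_iff, ← hsup]
    exact sup_le (sup_le (le_iSup (![p, q, s] : Fin 3 → Submodule R' M) 0)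
      (le_iSup (![p, q, s] : Fin 3 → Submodule R' M) 1))
      (le_iSup (![p, q, s] : Fin 3 → Submodule R' M) 2)

/-! ### The decomposition for relations between `D.Rule Φ` and `D.LinRule Φ` -/

section Rel

variable {D : OrdIntDiffAlg K F} {Φ : Set (F →ₐ[K] K)} {r : D.Free Φ → D.Free Φ → Prop}
  (hr : ∀ x y, D.Rule Φ x y → r x y)

open Realization

theorem diffOps_eq : D.diffOps Φ r = LinearMap.range (ofRel hr).ofCoeffs := by
  have h1 : (1 : RingQuot r) ∈ LinearMap.range (ofRel hr).ofCoeffs := ⟨Finsupp.single 0 1, by simp⟩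
  refine le_antisymm (adjoin_le_of_mul_mem h1 ?_) ?_
  · rintro x (rfl | ⟨f, rfl⟩) _ ⟨p, rfl⟩
    · exact (ofRel hr).der_mul_ofCoeffs p
    · exact ⟨_, ((ofRel hr).coe_mul_ofCoeffs ((ofRel hr).toFnAlg f) p).symm⟩
  · rintro _ ⟨p, rfl⟩
    induction p using Finsupp.induction_linear with
    | zero => simp
    | add f g hf hg => rw [map_add]; exact add_mem hf hg
    | single n a =>
      rw [ofCoeffs_single]
      rw [diffOps, Subalgebra.mem_toSubmodule]
      refine mul_mem (Algebra.adjoin_mono Set.subset_union_right a.2) (pow_mem ?_ n)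
      exact Algebra.subset_adjoin (Or.inl rfl)

theorem mem_intOps_iff {x : RingQuot r} :
    x ∈ D.intOps Φ r ↔ ∃ t, (ofRel hr).ofTensor t = x := by
  have h : D.intOps Φ r = Submodule.span K (Set.range fun p : F × F =>
      (ofRel hr).fn p.1 * (ofRel hr).int * (ofRel hr).fn p.2) := by
    simp only [intOps, map_mul]
    rfl
  rw [h]
  constructor
  · intro hx
    induction hx using Submodule.span_induction with
    | mem x hx =>
      obtain ⟨p, rfl⟩ := hx
      exact ⟨(ofRel hr).toFnAlg p.1 ⊗ₜ (ofRel hr).toFnAlg p.2, rfl⟩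
    | zero => exact ⟨0, map_zero _⟩
    | add x y _ _ hx hy =>
      obtain ⟨s, rfl⟩ := hx
      obtain ⟨t, rfl⟩ := hy
      exact ⟨s + t, map_add _ _ _⟩
    | smul c x _ hx =>
      obtain ⟨s, rfl⟩ := hx
      exact ⟨c • s, ofTensor_smul _ _ _⟩
  · rintro ⟨t, rfl⟩
    exact ofTensor_mem_span _ t

theorem mem_bdryOps_iff {x : RingQuot r} : x ∈ D.bdryOps Φ r ↔
    x ∈ TwoSidedIdeal.span (Set.range (ofRel hr).chr) := by
  rw [bdryOps, Submodule.restrictScalars_mem, TwoSidedIdeal.mem_asIdeal]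
  rfl

include hr in
theorem mul_mem_bdryOps (x : RingQuot r) {y : RingQuot r} (hy : y ∈ D.bdryOps Φ r) :
    x * y ∈ D.bdryOps Φ r := by
  rw [mem_bdryOps_iff hr] at hy ⊢
  exact TwoSidedIdeal.mul_mem_left _ _ _ hy

theorem chr_mul_mem_bdryOps (φ : D.Chars Φ) (x : RingQuot r) :
    (ofRel hr).chr φ * x ∈ D.bdryOps Φ r := by
  rw [mem_bdryOps_iff hr]
  exact TwoSidedIdeal.mul_mem_right _ _ _ (TwoSidedIdeal.subset_span ⟨φ, rfl⟩)

/-- Integration by parts lowers the power of `∂` and replaces `a` by `a'`, so the induction must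
keep `a` general; the evaluation terms fall into `(Φ)`. -/
theorem int_mul_ofCoeffs (p : ℕ →₀ (ofRel hr).fnAlg) :
    (ofRel hr).int * (ofRel hr).ofCoeffs p ∈
      D.diffOps Φ r ⊔ D.intOps Φ r ⊔ D.bdryOps Φ r := by
  induction p using Finsupp.induction_linear with
  | zero => simp
  | add f g hf hg => rw [map_add, mul_add]; exact add_mem hf hg
  | single n a =>
    induction n generalizing a with
    | zero =>
      refine Submodule.mem_sup_left (Submodule.mem_sup_right ((mem_intOps_iff hr).2
        ⟨1 ⊗ₜ a, ?_⟩))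
      simp
    | succ n ih =>
      obtain ⟨c, hc⟩ := (ofRel hr).int_mul_coe_mul_der a
      have h : (ofRel hr).int * (ofRel hr).ofCoeffs (Finsupp.single (n + 1) a) =
          (ofRel hr).ofCoeffs (Finsupp.single n a) -
            (ofRel hr).int * (ofRel hr).ofCoeffs (Finsupp.single n ((ofRel hr).fnDer a)) -
              c • ((ofRel hr).ev * (ofRel hr).der ^ n) := by
        simp only [ofCoeffs_single]
        rw [pow_succ', ← mul_assoc (a : RingQuot r), ← mul_assoc, ← mul_assoc, hc]
        simp only [sub_mul, smul_mul_assoc, mul_assoc]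
      rw [h]
      refine sub_mem (sub_mem ?_ (ih _)) ?_
      · refine Submodule.mem_sup_left (Submodule.mem_sup_left ?_)
        rw [diffOps_eq hr]
        exact ⟨_, rfl⟩
      · exact Submodule.mem_sup_right (Submodule.smul_mem _ c (chr_mul_mem_bdryOps hr _ _))

theorem int_mul_ofTensor (t : (ofRel hr).fnAlg ⊗[(ofRel hr).fnDer.constants] (ofRel hr).fnAlg) :
    (ofRel hr).int * (ofRel hr).ofTensor t ∈ D.intOps Φ r := by
  induction t with
  | zero => simp
  | add x y hx hy => rw [map_add, mul_add]; exact add_mem hx hy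
  | tmul a b =>
    obtain ⟨c, hc⟩ := (ofRel hr).int_mul_coe_mul_int a
    refine (mem_intOps_iff hr).2 ⟨c ⊗ₜ b - 1 ⊗ₜ (c * b), ?_⟩
    rw [map_sub, ofTensor_tmul, ofTensor_tmul, ofTensor_tmul, ← mul_assoc, ← mul_assoc, hc]
    push_cast
    rw [sub_mul, one_mul, ← mul_assoc]

theorem adjoin_gen : Algebra.adjoin K (Set.range (ofRel hr).onGen) = ⊤ := by
  rw [eq_top_iff]
  rintro x -
  obtain ⟨x, rfl⟩ := RingQuot.mkAlgHom_surjective K r x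
  induction x using FreeAlgebra.induction with
  | grade0 c => rw [AlgHom.commutes]; exact Subalgebra.algebraMap_mem _ c
  | grade1 g => exact Algebra.subset_adjoin ⟨g, by cases g <;> rfl⟩
  | mul a b ha hb => rw [map_mul]; exact mul_mem ha hb
  | add a b ha hb => rw [map_add]; exact add_mem ha hb

include hr in
-- The sum is a left ideal containing `1`. Left multiplication by a character always lands in `(Φ)`.
theorem sup_eq_top : D.diffOps Φ r ⊔ D.intOps Φ r ⊔ D.bdryOps Φ r = ⊤ := by
  have key := @adjoin_le_of_mul_mem K (RingQuot r) _ _ _ (Set.range (ofRel hr).onGen)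
    (D.diffOps Φ r ⊔ D.intOps Φ r ⊔ D.bdryOps Φ r)
    (Submodule.mem_sup_left (Submodule.mem_sup_left (one_mem (Algebra.adjoin K _)))) ?_
  · rw [adjoin_gen hr] at key
    exact top_le_iff.1 key
  rintro _ ⟨g, rfl⟩ t ht
  obtain ⟨xy, hxy, z, hz, rfl⟩ := Submodule.mem_sup.1 ht
  obtain ⟨x, hx, y, hy, rfl⟩ := Submodule.mem_sup.1 hxy
  rw [diffOps_eq hr] at hx
  obtain ⟨p, rfl⟩ := hx
  obtain ⟨s, rfl⟩ := (mem_intOps_iff hr).1 hy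
  have hdiff : ∀ p, (ofRel hr).ofCoeffs p ∈ D.diffOps Φ r ⊔ D.intOps Φ r ⊔ D.bdryOps Φ r :=
    fun p => Submodule.mem_sup_left (Submodule.mem_sup_left (by
      rw [diffOps_eq hr]; exact ⟨p, rfl⟩))
  have hint : ∀ s, (ofRel hr).ofTensor s ∈ D.diffOps Φ r ⊔ D.intOps Φ r ⊔ D.bdryOps Φ r :=
    fun s => Submodule.mem_sup_left (Submodule.mem_sup_right ((mem_intOps_iff hr).2 ⟨s, rfl⟩))
  rw [mul_add, mul_add]
  refine add_mem (add_mem ?_ ?_) (Submodule.mem_sup_right (mul_mem_bdryOps hr _ hz))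
  · cases g with
    | der =>
      obtain ⟨q, hq⟩ := (ofRel hr).der_mul_ofCoeffs p
      exact hq ▸ hdiff q
    | int => exact int_mul_ofCoeffs hr p
    | fn f => exact (coe_mul_ofCoeffs _ ((ofRel hr).toFnAlg f) p) ▸ hdiff _
    | chr φ => exact Submodule.mem_sup_right (chr_mul_mem_bdryOps hr φ _)
  · clear hy ht hxy
    induction s with
    | zero => simp
    | add x y hx hy => rw [map_add, mul_add]; exact add_mem hx hy
    | tmul a b =>
      cases g with
      | der =>
        -- `∂ a ∫ b = a b + a' ∫ b`, because `∂ ∫ = 1`.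
        have : (ofRel hr).der * (ofRel hr).ofTensor (a ⊗ₜ b) =
            (ofRel hr).ofCoeffs (Finsupp.single 0 (a * b)) +
              (ofRel hr).ofTensor ((ofRel hr).fnDer a ⊗ₜ b) := by
          rw [ofTensor_tmul, ofTensor_tmul, ofCoeffs_single, ← mul_assoc, ← mul_assoc, der_mul_coe,
            add_mul, mul_assoc (a : RingQuot r), (ofRel hr).der_int, add_mul]
          simp
        exact this ▸ add_mem (hdiff _) (hint _)
      | int =>
        exact Submodule.mem_sup_left (Submodule.mem_sup_right (int_mul_ofTensor hr _))
      | fn f =>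
        have : (ofRel hr).fn f * (ofRel hr).ofTensor (a ⊗ₜ b) =
            (ofRel hr).ofTensor (((ofRel hr).toFnAlg f * a) ⊗ₜ b) := by
          simp [toFnAlg, mul_assoc]
        exact this ▸ hint _
      | chr φ => exact Submodule.mem_sup_right (chr_mul_mem_bdryOps hr φ _)

variable (hr' : ∀ x y, r x y → D.LinRule Φ x y)

/-- The action of the operators on `A[∂] ⊕ A ∂⁻¹ A`, for `A` the algebra generated by the
functions. -/
noncomputable def pseudoHom : RingQuot r →ₐ[K] Module.End K (ofRel hr).fnDer.PseudoOp :=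
  RingQuot.liftAlgHom K ⟨(ofRel hr).pseudo.onFree, fun {x y} hxy => by
    -- A linear relation imposed by `r` already holds in the quotient, hence in the algebra
    -- generated by the functions, which is what acts.
    have h := RingQuot.mkAlgHom_rel K hxy
    cases hr' x y hxy with
    | of_rule h => exact onFree_eq_of_rule _ h
    | fn_add f g =>
      have h' : (ofRel hr).toFnAlg (f + g) = (ofRel hr).toFnAlg f + (ofRel hr).toFnAlg g :=
        Subtype.ext (by rw [map_add] at h; exact h)
      simp [pseudo, h']
    | fn_smul c f =>
      have h' : (ofRel hr).toFnAlg (c • f) = c • (ofRel hr).toFnAlg f :=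
        Subtype.ext (by rw [map_smul] at h; exact h)
      simp [pseudo, h']⟩

theorem pseudoHom_mk (x : D.Free Φ) :
    pseudoHom hr hr' (RingQuot.mkAlgHom K r x) = (ofRel hr).pseudo.onFree x :=
  RingQuot.liftAlgHom_mkAlgHom_apply ..

theorem pseudoHom_bdry {x : RingQuot r} (hx : x ∈ D.bdryOps Φ r) : pseudoHom hr hr' x = 0 := by
  rw [mem_bdryOps_iff hr] at hx
  have : TwoSidedIdeal.span (Set.range (ofRel hr).chr) ≤
      TwoSidedIdeal.ker (pseudoHom hr hr') := by
    rw [TwoSidedIdeal.span_le]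
    rintro _ ⟨φ, rfl⟩
    exact (TwoSidedIdeal.mem_ker _).2 ((pseudoHom_mk hr hr' _).trans (onFree_chr _ φ))
  exact (TwoSidedIdeal.mem_ker _).1 (this hx)

include hr hr' in
theorem isInternal_diffOps_intOps_bdryOps : DirectSum.IsInternal
    (![D.diffOps Φ r, D.intOps Φ r, D.bdryOps Φ r] : Fin 3 → Submodule K (RingQuot r)) := by
  refine isInternal_fin_three (sup_eq_top hr) fun x hx y hy z hz h => ?_
  rw [diffOps_eq hr] at hx
  obtain ⟨p, rfl⟩ := hx
  obtain ⟨t, rfl⟩ := (mem_intOps_iff hr).1 hy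
  have hfn : ∀ f, pseudoHom hr hr' ((ofRel hr).fn f) = (ofRel hr).pseudo.fn f :=
    fun f => (pseudoHom_mk hr hr' _).trans (onFree_fn _ f)
  -- Once the coefficients `p` and `t` vanish, the relation itself leaves `z = 0`.
  obtain ⟨rfl, rfl⟩ := eq_zero_of_add_eq_zero _ hfn
    ((pseudoHom_mk hr hr' _).trans (onFree_der _)) ((pseudoHom_mk hr hr' _).trans (onFree_int _))
    (pseudoHom_bdry hr hr' hz) h
  simpa using h

end Rel

end

end OrdIntDiffAlg

theorem mainTheorem4 {K F : Type*} [Field K] [CommRing F] [Algebra K F]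
    (D : OrdIntDiffAlg K F) (Φ : Set (F →ₐ[K] K)) :
    DirectSum.IsInternal
      (![D.diffOps Φ (D.Rule Φ), D.intOps Φ (D.Rule Φ), D.bdryOps Φ (D.Rule Φ)] :
        Fin 3 → Submodule K (D.Op Φ)) ∧
    DirectSum.IsInternal
      (![D.diffOps Φ (D.LinRule Φ), D.intOps Φ (D.LinRule Φ), D.bdryOps Φ (D.LinRule Φ)] :
        Fin 3 → Submodule K (D.ExpOp Φ)) :=
  ⟨D.isInternal_diffOps_intOps_bdryOps (fun _ _ h => h) fun _ _ h => .of_rule h,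
    D.isInternal_diffOps_intOps_bdryOps (fun _ _ h => .of_rule h) fun _ _ h => h⟩
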